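/- Let $\mathbb F=\mathbb R$ or $\mathbb F=\mathbb C$. For a compact Hausdorff space $K$, a Banach space $E$ over $\mathbb F$ and a linear subspace $\mathcal H\subset \mathcal C(K,E)$ (supremum norm), let the canonical scalar function space $\mathcal A\subset\mathcal C(K,\mathbb F)$ of $\mathcal H$ be the closed linear span of $\{e^*\circ h: e^*\in E^*,\ h\in\mathcal H\}$. The Choquet boundary $\operatorname{Ch}_{\mathcal H}K$ is the set of those $x\in K$ for which the evaluation functional $a\mapsto a(x)$ is an extreme point of the closed unit ball of $\mathcal A^*$. A point $x\in K$ is a weak peak point with respect to $\mathcal H$ if for every $\varepsilon\in(0,1)$, every $e\in E$ and every neighbourhood $U$ of $x$ there exists $h\in\mathcal A$ with $\|h\|\le 1$ such that $h(x)>1-\varepsilon$ (in particular, $h(x)$ is real), $|h|\le\varepsilon$ on $\operatorname{Ch}_{\mathcal H}K\setminus U$, and the function $h\otimes e\colon y\mapsto h(y)e$ belongs to $\mathcal H$. **Proposition.** For $i=1,2$, let $K_i$ be a compact Hausdorff space, let $E_i$ be a Banach space over $\mathbb F$, and let $\mathcal H_i$ be a closed subspace of $\mathcal C(K_i,E_i)$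 such that each point of $\operatorname{Ch}_{\mathcal H_i}K_i$ is a weak peak point with respect to $\mathcal H_i$. Suppose that $E_1$ does not contain an isomorphic copy of $c_0$ (the space of null sequences in $\mathbb F$ with the supremum norm), that $\operatorname{Ch}_{\mathcal H_1}K_1$ is finite, and that $\mathcal H_1$ is isomorphic to $\mathcal H_2$, that is, there is a bounded linear bijection $\mathcal H_1\to\mathcal H_2$ with bounded inverse. Then $\operatorname{Ch}_{\mathcal H_2}K_2$ is finite. -/

import Mathlib

open scoped Topology ZeroAtInfty

namespace VectorFunctionSpace

section

variable {𝕜 K E : Type*} [RCLike 𝕜] [TopologicalSpace K] [CompactSpace K]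
  [NormedAddCommGroup E] [NormedSpace 𝕜 E]

/-- The canonical scalar function space `𝒜 ⊆ C(K, 𝕜)` associated with a subspace `H` of `C(K, E)`:
the closed linear span of the functions `x ↦ φ (h x)`, where `φ` is a bounded linear functional
on `E` and `h ∈ H`. -/
noncomputable def scalarSpace (H : Submodule 𝕜 C(K, E)) : Submodule 𝕜 C(K, 𝕜) :=
  (Submodule.span 𝕜
    {g : C(K, 𝕜) | ∃ φ : StrongDual 𝕜 E, ∃ h ∈ H, ∀ x, g x = φ (h x)}).topologicalClosure

/-- The evaluation functional `a ↦ a x` on a space `A` of scalar continuous functions, as an element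
of the normed dual of `A`. -/
noncomputable def evalFunctional (A : Submodule 𝕜 C(K, 𝕜)) (x : K) : StrongDual 𝕜 A :=
  (ContinuousMap.evalCLM 𝕜 x).comp A.subtypeL

/-- The Choquet boundary of a subspace `H` of `C(K, E)`: the set of those points `x` of `K` for
which evaluation at `x` is an extreme point of the closed unit ball of the dual of the canonical
scalar function space of `H`. -/
def choquetBoundary (H : Submodule 𝕜 C(K, E)) : Set K :=
  {x | evalFunctional (scalarSpace H) x ∈
    Set.extremePoints ℝ {s : StrongDual 𝕜 (scalarSpace H) | ‖s‖ ≤ 1}}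

/-- The function `f ⊗ e : x ↦ f x • e`. -/
def tensor (f : C(K, 𝕜)) (e : E) : C(K, E) :=
  ⟨fun x => f x • e, by fun_prop⟩

/-- A point `x` is a weak peak point with respect to `H` if for each `ε ∈ (0, 1)`, each `e : E` and
each neighbourhood `U` of `x` there is a function `h` in the closed unit ball of the canonical
scalar function space such that `h x > 1 - ε` (in particular `h x` is real), `|h| ≤ ε` on the part of
the Choquet boundary outside `U`, and `h ⊗ e ∈ H`. -/
def IsWeakPeakPoint (H : Submodule 𝕜 C(K, E)) (x : K) : Prop :=
  ∀ ε : ℝ, 0 < ε → ε < 1 → ∀ e : E, ∀ U ∈ 𝓝 x,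
    ∃ h ∈ scalarSpace H, ‖h‖ ≤ 1 ∧
      (RCLike.im (h x) = 0 ∧ 1 - ε < RCLike.re (h x)) ∧
      (∀ y ∈ choquetBoundary H \ U, ‖h y‖ ≤ ε) ∧
      tensor h e ∈ H

end

/-- The normed space `E` over `𝕜` contains an isomorphic copy of `c₀`, the space of sequences in `𝕜`
tending to zero with the supremum norm (functions vanishing at infinity on the discrete space `ℕ`):
some linear subspace of `E` is linearly homeomorphic to `c₀`. -/
def ContainsCZero (𝕜 E : Type*) [RCLike 𝕜] [NormedAddCommGroup E] [NormedSpace 𝕜 E] : Prop :=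
  ∃ V : Submodule 𝕜 E, Nonempty (C₀(ℕ, 𝕜) ≃L[𝕜] V)

end VectorFunctionSpace

/-!
The Choquet boundary of `H` is norming: every nonzero `h ∈ H` attains its norm there
(`exists_mem_choquetBoundary_norm_eq`). For scalar functions this follows from Krein–Milman, which
gives an extreme point of the dual unit ball of the canonical scalar function space at which the
norm is attained, together with the fact that such extreme points are unimodular multiples of
evaluations (`exists_extremePoint_extension` and `exists_eq_smul_eval_of_extreme`).

If the Choquet boundary of `H₂` is infinite and consists of weak peak points, functions `hₙ ⊗ e`
with `hₙ` peaking in disjoint relatively open subsets of the boundary form a sequence in `H₂` that is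
bounded away from zero and satisfies `‖∑ cₙ • hₙ ⊗ e‖ ≤ C * max |cₙ|` (`exists_seq_norm_sum_le_of_infinite`). Both
properties survive the isomorphism to `H₁`. Since the Choquet boundary of `H₁` is finite, infinitely
many members of the transported sequence attain their norms at one and the same point, and
evaluating them there gives a sequence in `E₁` with the same two properties. By the
Bessaga–Pełczyński theorem (`containsCZero_of_norm_sum_le`, deduced from Rosenthal's lemma
`exists_injective_offDiagonal_sum_le`), `E₁` then contains a copy of `c₀`.
-/

namespace VectorFunctionSpace

/-! ### Extreme points of dual unit balls -/

section Dual

variable {𝕜 V : Type*} [RCLike 𝕜] [NormedAddCommGroup V] [NormedSpace 𝕜 V]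

theorem isClosed_preimage_unitBall :
    IsClosed (WeakDual.toStrongDual (𝕜 := 𝕜) (E := V) ⁻¹' {s | ‖s‖ ≤ 1}) := by
  convert WeakDual.isClosed_closedBall (0 : StrongDual 𝕜 V) 1 using 2
  ext s
  simp

/-- A nonempty weak-* closed extreme subset of a dual unit ball contains an extreme point of the
ball: it is weak-* compact by Banach–Alaoglu, so the Krein–Milman lemma applies. -/
theorem exists_mem_extremePoints_of_isExtreme {F : Set (StrongDual 𝕜 V)} (hne : F.Nonempty)
    (hF : IsExtreme ℝ {s : StrongDual 𝕜 V | ‖s‖ ≤ 1} F)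
    (hcl : IsClosed (WeakDual.toStrongDual (𝕜 := 𝕜) (E := V) ⁻¹' F)) :
    ∃ s ∈ F, s ∈ Set.extremePoints ℝ {s : StrongDual 𝕜 V | ‖s‖ ≤ 1} := by
  have : LocallyConvexSpace ℝ (WeakDual 𝕜 V) :=
    LocallyConvexSpace.induced (t := Pi.topologicalSpace)
      ({ toFun := fun s x => s x, map_add' := fun _ _ => rfl, map_smul' := fun _ _ => rfl } :
        WeakDual 𝕜 V →ₗ[ℝ] (V → 𝕜))
  have hcomp : IsCompact (WeakDual.toStrongDual (𝕜 := 𝕜) (E := V) ⁻¹' F) := by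
    refine (WeakDual.isCompact_closedBall (0 : StrongDual 𝕜 V) 1).of_isClosed_subset hcl ?_
    intro s hs
    simpa using! hF.1 hs
  obtain ⟨s, hs⟩ := hcomp.extremePoints_nonempty hne
  have hs' : WeakDual.toStrongDual s ∈ Set.extremePoints ℝ F := hs
  exact ⟨_, hs.1, hF.extremePoints_subset_extremePoints hs'⟩

/-- Every nonzero vector attains its norm at an extreme point of the dual unit ball. -/
theorem exists_mem_extremePoints_apply_eq_norm {a : V} (ha : a ≠ 0) :
    ∃ s ∈ Set.extremePoints ℝ {s : StrongDual 𝕜 V | ‖s‖ ≤ 1}, RCLike.re (s a) = ‖a‖ := by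
  have hle : ∀ s : StrongDual 𝕜 V, ‖s‖ ≤ 1 → RCLike.re (s a) ≤ ‖a‖ := fun s hs =>
    (RCLike.re_le_norm _).trans ((s.le_opNorm a).trans (mul_le_of_le_one_left (norm_nonneg _) hs))
  suffices h : ∃ s ∈ {s : StrongDual 𝕜 V | ‖s‖ ≤ 1 ∧ RCLike.re (s a) = ‖a‖},
      s ∈ Set.extremePoints ℝ {s : StrongDual 𝕜 V | ‖s‖ ≤ 1} by
    obtain ⟨s, hs, hs'⟩ := h
    exact ⟨s, hs', hs.2⟩
  refine exists_mem_extremePoints_of_isExtreme ?_ ⟨fun s hs => hs.1, ?_⟩ ?_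
  · obtain ⟨g, hg, hga⟩ := exists_dual_vector 𝕜 a (norm_ne_zero_iff.2 ha)
    exact ⟨g, hg.le, by simp [hga]⟩
  · rintro x hx y hy z ⟨-, hz⟩ ⟨α, β, hα, hβ, hαβ, rfl⟩
    refine ⟨hx, le_antisymm (hle x hx) ?_⟩
    have h : α * RCLike.re (x a) + β * RCLike.re (y a) = ‖a‖ := by
      simpa [RCLike.smul_re] using hz
    have hy' := mul_le_mul_of_nonneg_left (hle y hy) hβ.le
    refine le_of_mul_le_mul_left ?_ hα
    have : β = 1 - α := by linarith
    subst this
    linarith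
  · refine IsClosed.inter ?_ ?_
    · exact isClosed_preimage_unitBall
    · exact isClosed_eq (RCLike.continuous_re.comp (WeakDual.eval_continuous a)) continuous_const

/-- Extreme points of the dual unit ball of a subspace extend to extreme points of the dual unit
ball of the whole space, since the norm-one extensions form a weak-* closed extreme set. -/
theorem exists_extremePoint_extension (A : Submodule 𝕜 V) {s : StrongDual 𝕜 A}
    (hs : s ∈ Set.extremePoints ℝ {s : StrongDual 𝕜 A | ‖s‖ ≤ 1}) :
    ∃ l ∈ Set.extremePoints ℝ {l : StrongDual 𝕜 V | ‖l‖ ≤ 1}, ∀ a : A, l a = s a := by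
  suffices h : ∃ l ∈ {l : StrongDual 𝕜 V | ‖l‖ ≤ 1 ∧ ∀ a : A, l a = s a},
      l ∈ Set.extremePoints ℝ {l : StrongDual 𝕜 V | ‖l‖ ≤ 1} by
    obtain ⟨l, hl, hl'⟩ := h
    exact ⟨l, hl', hl.2⟩
  refine exists_mem_extremePoints_of_isExtreme ?_ ⟨fun s hs => hs.1, ?_⟩ ?_
  · obtain ⟨g, hg, hgs⟩ := exists_extension_norm_eq A s
    exact ⟨g, hgs.le.trans hs.1, hg⟩
  · rintro x hx y hy z ⟨-, hz⟩ ⟨α, β, hα, hβ, hαβ, rfl⟩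
    have hr : ∀ l : StrongDual 𝕜 V, ‖l‖ ≤ 1 → ‖l.comp A.subtypeL‖ ≤ 1 := fun l hl =>
      ContinuousLinearMap.opNorm_le_bound _ zero_le_one fun a =>
        (l.le_opNorm a).trans (mul_le_mul_of_nonneg_right hl (norm_nonneg _))
    have := hs.2 (hr x hx) (hr y hy) ⟨α, β, hα, hβ, hαβ, by ext a; simpa using hz a⟩
    exact ⟨hx, fun a => by rw [← this]; rfl⟩
  · refine IsClosed.inter ?_ ?_
    · exact isClosed_preimage_unitBall
    · have : {l : StrongDual 𝕜 V | ∀ a : A, l a = s a} = ⋂ a : A, {l | l a = s a} := by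
        ext; simp
      change IsClosed (WeakDual.toStrongDual (𝕜 := 𝕜) (E := V) ⁻¹' {l | ∀ a : A, l a = s a})
      rw [this, Set.preimage_iInter]
      exact isClosed_iInter fun a => isClosed_eq (WeakDual.eval_continuous (a : V)) continuous_const

/-- Multiplication by a unimodular scalar preserves the extreme points of the dual unit ball. -/
theorem smul_mem_extremePoints {c : 𝕜} (hc : ‖c‖ = 1) {s : StrongDual 𝕜 V}
    (hs : s ∈ Set.extremePoints ℝ {s : StrongDual 𝕜 V | ‖s‖ ≤ 1}) :
    c • s ∈ Set.extremePoints ℝ {s : StrongDual 𝕜 V | ‖s‖ ≤ 1} := by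
  have hc0 : c ≠ 0 := norm_ne_zero_iff.1 (by simp [hc])
  have hn : ∀ x : StrongDual 𝕜 V, ‖x‖ ≤ 1 → ‖c⁻¹ • x‖ ≤ 1 := fun x hx => by
    simpa [norm_smul, hc] using hx
  refine ⟨by simpa [norm_smul, hc] using hs.1, ?_⟩
  rintro x hx y hy ⟨α, β, hα, hβ, hαβ, h⟩
  have := hs.2 (hn x hx) (hn y hy) ⟨α, β, hα, hβ, hαβ, by
    rw [smul_comm α, smul_comm β]
    exact (smul_add c⁻¹ _ _).symm.trans (by rw [h, inv_smul_smul₀ hc0])⟩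
  rw [← this, smul_inv_smul₀ hc0]

end Dual

/-! ### Extreme points of the dual unit ball of `C(K, 𝕜)` -/

section Arens

variable {𝕜 K : Type*} [RCLike 𝕜] [TopologicalSpace K] [CompactSpace K]

/-- If multiplication by `f` and `1 - f`, where `0 ≤ f ≤ 1`, splits a functional into two parts,
then the norms of the two parts add up to at most the norm of the functional. -/
theorem norm_apply_add_norm_apply_le (l : StrongDual 𝕜 C(K, 𝕜)) (f : C(K, 𝕜))
    (hf : ∀ x, ∃ t : ℝ, 0 ≤ t ∧ t ≤ 1 ∧ f x = t) (g₁ g₂ : C(K, 𝕜)) (h₁ : ‖g₁‖ ≤ 1)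
    (h₂ : ‖g₂‖ ≤ 1) : ‖l (f * g₁)‖ + ‖l ((1 - f) * g₂)‖ ≤ ‖l‖ := by
  -- Rotate both values onto the positive half-axis, and use that `f * g₁ + (1 - f) * g₂` is a
  -- pointwise convex combination.
  obtain ⟨c, hc, hc'⟩ := RCLike.exists_norm_eq_mul_self (l (f * g₁))
  obtain ⟨d, hd, hd'⟩ := RCLike.exists_norm_eq_mul_self (l ((1 - f) * g₂))
  have hnorm : ‖c • (f * g₁) + d • ((1 - f) * g₂)‖ ≤ 1 := by
    refine (ContinuousMap.norm_le _ zero_le_one).2 fun x => ?_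
    obtain ⟨t, ht0, ht1, ht⟩ := hf x
    have hx₁ := (g₁.norm_coe_le_norm x).trans h₁
    have hx₂ := (g₂.norm_coe_le_norm x).trans h₂
    have e₁ : ‖(t : 𝕜)‖ = t := by simp [abs_of_nonneg ht0]
    have e₂ : ‖(1 - t : 𝕜)‖ = 1 - t := by
      rw [← RCLike.ofReal_one, ← RCLike.ofReal_sub, RCLike.norm_ofReal,
        abs_of_nonneg (by linarith)]
    calc ‖(c • (f * g₁) + d • ((1 - f) * g₂)) x‖
        ≤ ‖c * ((t : 𝕜) * g₁ x)‖ + ‖d * ((1 - t : 𝕜) * g₂ x)‖ := by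
          simpa [ht] using! norm_add_le (c * ((t : 𝕜) * g₁ x)) (d * ((1 - t : 𝕜) * g₂ x))
      _ = t * ‖g₁ x‖ + (1 - t) * ‖g₂ x‖ := by simp only [norm_mul, hc, hd, e₁, e₂, one_mul]
      _ ≤ 1 := by nlinarith
  have := (l.le_opNorm _).trans (mul_le_of_le_one_right (norm_nonneg l) hnorm)
  rw [map_add, map_smul, map_smul, smul_eq_mul, smul_eq_mul, ← hc', ← hd', ← RCLike.ofReal_add,
    RCLike.norm_ofReal, abs_of_nonneg (by positivity)] at this
  exact this

/-- For an extreme point `l` of the dual unit ball, multiplication by a function `f` with values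
in `[0, 1]` acts on `l` as a scalar: the parts `l (f * ·)` and `l ((1 - f) * ·)` have norms adding
up to `1`, so extremeness makes them proportional to `l`. -/
theorem exists_apply_mul_eq_of_extreme {l : StrongDual 𝕜 C(K, 𝕜)} (hl1 : ‖l‖ = 1)
    (hl : l ∈ Set.extremePoints ℝ {l : StrongDual 𝕜 C(K, 𝕜) | ‖l‖ ≤ 1}) (f : C(K, 𝕜))
    (hf : ∀ x, ∃ t : ℝ, 0 ≤ t ∧ t ≤ 1 ∧ f x = t) :
    ∃ c : ℝ, ∀ g, l (f * g) = (c : 𝕜) * l g := by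
  set u : StrongDual 𝕜 C(K, 𝕜) := l.comp (ContinuousLinearMap.mul 𝕜 C(K, 𝕜) f) with hu
  set v : StrongDual 𝕜 C(K, 𝕜) := l.comp (ContinuousLinearMap.mul 𝕜 C(K, 𝕜) (1 - f)) with hv
  have huv : u + v = l := by
    ext g
    simp [hu, hv]
  have hle : ‖u‖ + ‖v‖ ≤ 1 := by
    by_contra! h
    obtain ⟨g₁, hg₁, h₁⟩ := u.exists_lt_apply_of_lt_opNorm
      (r := ‖u‖ - (‖u‖ + ‖v‖ - 1) / 2) (by linarith)
    obtain ⟨g₂, hg₂, h₂⟩ := v.exists_lt_apply_of_lt_opNorm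
      (r := ‖v‖ - (‖u‖ + ‖v‖ - 1) / 2) (by linarith)
    have := norm_apply_add_norm_apply_le l f hf g₁ g₂ hg₁.le hg₂.le
    have e₁ : u g₁ = l (f * g₁) := rfl
    have e₂ : v g₂ = l ((1 - f) * g₂) := rfl
    rw [e₁] at h₁
    rw [e₂] at h₂
    linarith
  have hge : 1 ≤ ‖u‖ + ‖v‖ := by
    rw [← hl1, ← huv]
    exact norm_add_le u v
  have hnorm : ∀ w : StrongDual 𝕜 C(K, 𝕜), ‖w‖ ≠ 0 → ‖(‖w‖⁻¹ : ℝ) • w‖ ≤ 1 := fun w hw => by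
    simp [norm_smul, hw]
  refine ⟨‖u‖, fun g => ?_⟩
  change u g = _
  rcases eq_or_ne ‖u‖ 0 with hu0 | hu0
  · have : u = 0 := by rwa [ContinuousLinearMap.opNorm_zero_iff] at hu0
    simp [this]
  rcases eq_or_ne ‖v‖ 0 with hv0 | hv0
  · have : v = 0 := by rwa [ContinuousLinearMap.opNorm_zero_iff] at hv0
    have : u = l := by rw [← huv, this, add_zero]
    rw [this, hl1]
    simp
  have := hl.2 (hnorm u hu0) (hnorm v hv0) ⟨‖u‖, ‖v‖, by positivity, by positivity, by linarith, by
    rw [smul_inv_smul₀ hu0, smul_inv_smul₀ hv0, huv]⟩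
  rw [← this]
  simp [RCLike.real_smul_eq_coe_mul, hu0]

variable [T2Space K]

/-- Arens–Kelley: a norm-one extreme point of the dual unit ball of `C(K, 𝕜)` is a unimodular
multiple of a point evaluation. -/
theorem exists_eq_smul_eval_of_extreme {l : StrongDual 𝕜 C(K, 𝕜)} (hl1 : ‖l‖ = 1)
    (hl : l ∈ Set.extremePoints ℝ {l : StrongDual 𝕜 C(K, 𝕜) | ‖l‖ ≤ 1}) :
    ∃ x : K, ∃ c : 𝕜, ‖c‖ = 1 ∧ ∀ g, l g = c * g x := by
  -- The functions that act on `l` as scalars form a subspace, which is everything.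
  let S : Submodule 𝕜 C(K, 𝕜) :=
    { carrier := {f | ∃ c : 𝕜, ∀ g, l (f * g) = c * l g}
      add_mem' := by
        rintro f f' ⟨c, hc⟩ ⟨c', hc'⟩
        exact ⟨c + c', fun g => by rw [add_mul, map_add, hc, hc', add_mul]⟩
      zero_mem' := ⟨0, fun g => by simp⟩
      smul_mem' := by
        rintro a f ⟨c, hc⟩
        exact ⟨a * c, fun g => by rw [smul_mul_assoc, map_smul, hc, smul_eq_mul, mul_assoc]⟩ }
  have hunit : ∀ f : C(K, 𝕜), (∀ x, ∃ t : ℝ, 0 ≤ t ∧ t ≤ 1 ∧ f x = t) → f ∈ S := fun f hf => by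
    obtain ⟨c, hc⟩ := exists_apply_mul_eq_of_extreme hl1 hl f hf
    exact ⟨c, hc⟩
  have hone : (1 : C(K, 𝕜)) ∈ S := ⟨1, fun g => by simp⟩
  let ι : C(ℝ, 𝕜) := ⟨fun t => (t : 𝕜), RCLike.continuous_ofReal⟩
  have hreal : ∀ f : C(K, ℝ), ι.comp f ∈ S := fun f => by
    -- `f` is an affine image of `(f + M) / (2 * M)`, which takes values in `[0, 1]`.
    set M : ℝ := ‖f‖ + 1 with hM
    have hM0 : 0 < M := by positivity
    have h := hunit (ι.comp ⟨fun x => (f x + M) / (2 * M), by fun_prop⟩) fun x => by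
      have := abs_le.1 ((Real.norm_eq_abs _).symm ▸ f.norm_coe_le_norm x)
      refine ⟨(f x + M) / (2 * M), ?_, ?_, rfl⟩
      · exact div_nonneg (by linarith) (by linarith)
      · rw [div_le_one (by linarith)]
        linarith
    have := S.sub_mem (S.smul_mem ((2 * M : ℝ) : 𝕜) h) (S.smul_mem (M : 𝕜) hone)
    convert this using 1
    ext x
    have : ι (f x) = ι ((2 * M) * ((f x + M) / (2 * M)) - M) := by
      congr 1
      field_simp
      ring
    simpa [ι, RCLike.real_smul_eq_coe_mul] using this
  have htop : ∀ f, f ∈ S := fun f => by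
    have := S.add_mem (hreal ⟨fun x => RCLike.re (f x), by fun_prop⟩)
      (S.smul_mem (RCLike.I : 𝕜) (hreal ⟨fun x => RCLike.im (f x), by fun_prop⟩))
    convert this using 1
    ext x
    simp [ι, mul_comm (RCLike.I : 𝕜), RCLike.re_add_im]
  have hmul : ∀ f g, l (f * g) * l 1 = l f * l g := fun f g => by
    obtain ⟨c, hc⟩ := htop f
    rw [hc g, show l f = c * l 1 by rw [← hc 1, mul_one]]
    ring
  have h1 : l 1 ≠ 0 := fun h => by
    have : l = 0 := by
      ext f
      obtain ⟨c, hc⟩ := htop f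
      rw [← mul_one f, hc 1, h]
      simp
    simp [this] at hl1
  let χ : C(K, 𝕜) →ₐ[𝕜] 𝕜 := AlgHom.ofLinearMap ((l 1)⁻¹ • (l : C(K, 𝕜) →ₗ[𝕜] 𝕜))
    (by simp [h1]) (fun f g => by
      have := hmul f g
      simp only [LinearMap.smul_apply, ContinuousLinearMap.coe_coe, smul_eq_mul]
      field_simp
      rwa [mul_comm])
  obtain ⟨x, hx⟩ := (WeakDual.CharacterSpace.continuousMapEval_bijective K 𝕜).2
    (WeakDual.CharacterSpace.equivAlgHom.symm χ)
  have hval : ∀ g, l g = l 1 * g x := fun g => by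
    have : g x = (l 1)⁻¹ * l g := by
      have := DFunLike.congr_fun hx g
      simpa using! this
    rw [this, mul_inv_cancel_left₀ h1]
  refine ⟨x, l 1, le_antisymm ?_ ?_, hval⟩
  · have : Nonempty K := ⟨x⟩
    simpa [hl1] using l.le_opNorm 1
  · rw [← hl1]
    refine l.opNorm_le_bound (norm_nonneg _) fun g => ?_
    rw [hval g, norm_mul]
    gcongr
    exact g.norm_coe_le_norm x

end Arens

/-! ### The Choquet boundary is norming -/

section Choquet

variable {𝕜 K E : Type*} [RCLike 𝕜] [TopologicalSpace K] [CompactSpace K] [T2Space K]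
  [NormedAddCommGroup E] [NormedSpace 𝕜 E]

/-- Every nonzero function in the canonical scalar function space attains its norm on the Choquet
boundary. -/
theorem exists_mem_choquetBoundary_norm_eq_of_scalar (H : Submodule 𝕜 C(K, E)) {a : C(K, 𝕜)}
    (haA : a ∈ scalarSpace H) (ha : a ≠ 0) : ∃ x ∈ choquetBoundary H, ‖a x‖ = ‖a‖ := by
  have ha' : (⟨a, haA⟩ : scalarSpace H) ≠ 0 := fun h => ha (congrArg Subtype.val h)
  obtain ⟨s, hs, hsa⟩ := exists_mem_extremePoints_apply_eq_norm (𝕜 := 𝕜) ha'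
  obtain ⟨l, hl, hls⟩ := exists_extremePoint_extension _ hs
  have hla : RCLike.re (l a) = ‖a‖ := by simpa [← hls] using hsa
  have hl1 : ‖l‖ = 1 := by
    refine le_antisymm hl.1 ?_
    have h := (RCLike.re_le_norm _).trans (l.le_opNorm a)
    rw [hla] at h
    exact le_of_mul_le_mul_right (by simpa using h) (norm_pos_iff.2 ha)
  obtain ⟨x, c, hc, hlc⟩ := exists_eq_smul_eval_of_extreme hl1 hl
  have hc0 : c ≠ 0 := norm_ne_zero_iff.1 (by simp [hc])
  refine ⟨x, ?_, le_antisymm (a.norm_coe_le_norm x) ?_⟩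
  · have hev : evalFunctional (scalarSpace H) x = c⁻¹ • s := by
      ext b
      change (b : C(K, 𝕜)) x = c⁻¹ * s b
      rw [← hls, hlc, inv_mul_cancel_left₀ hc0]
    rw [choquetBoundary, Set.mem_ofPred_eq, hev]
    exact smul_mem_extremePoints (by simp [hc]) hs
  · rw [← hla, hlc]
    exact (RCLike.re_le_norm _).trans (by simp [hc])

/-- Every nonzero function in `H` attains its norm on the Choquet boundary: compose with a norming
functional at a point where the norm is attained on `K`. -/
theorem exists_mem_choquetBoundary_norm_eq (H : Submodule 𝕜 C(K, E)) {h : C(K, E)}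
    (hH : h ∈ H) (h0 : h ≠ 0) : ∃ x ∈ choquetBoundary H, ‖h x‖ = ‖h‖ := by
  have hK : Nonempty K := by
    by_contra hK
    rw [not_nonempty_iff] at hK
    exact h0 (ContinuousMap.ext fun x => isEmptyElim x)
  obtain ⟨p, -, hp'⟩ := isCompact_univ.exists_isMaxOn Set.univ_nonempty
    (by fun_prop : Continuous fun x => ‖h x‖).continuousOn
  have hp : ‖h‖ = ‖h p‖ :=
    le_antisymm ((ContinuousMap.norm_le _ (norm_nonneg _)).2 fun x => hp' (Set.mem_univ x)) (h.norm_coe_le_norm p)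
  have hp0 : ‖h p‖ ≠ 0 := hp ▸ norm_ne_zero_iff.2 h0
  obtain ⟨φ, hφ, hφp⟩ := exists_dual_vector 𝕜 (h p) hp0
  let a : C(K, 𝕜) := ⟨fun x => φ (h x), by fun_prop⟩
  have hap : ‖a p‖ = ‖h‖ := by
    change ‖φ (h p)‖ = _
    rw [hφp, hp]
    simp
  obtain ⟨x, hx, hxa⟩ := exists_mem_choquetBoundary_norm_eq_of_scalar H (a := a)
    (Submodule.le_topologicalClosure _ (Submodule.subset_span ⟨φ, h, hH, fun _ => rfl⟩))
    (fun h => hp0 (by rw [← hp, ← hap, h]; simp))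
  refine ⟨x, hx, le_antisymm (h.norm_coe_le_norm x) ?_⟩
  calc ‖h‖ = ‖a p‖ := hap.symm
    _ ≤ ‖a‖ := a.norm_coe_le_norm p
    _ = ‖φ (h x)‖ := hxa.symm
    _ ≤ ‖h x‖ := by simpa [hφ] using φ.le_opNorm (h x)

end Choquet

/-! ### Rosenthal's disjointification lemma -/

/-- If the off-diagonal row sums of an infinite matrix are at most `(k + 1) * ε`, then some infinite
principal submatrix has off-diagonal row sums at most `ε`.

Split the index set into infinitely many infinite blocks. If no block works, each block contains a
row whose sum over the rest of its block exceeds `ε`; the submatrix formed by one such index from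
each block has row sums at most `k * ε`, and the process is repeated. -/
theorem exists_injective_offDiagonal_sum_le (ε : ℝ) (k : ℕ) : ∀ a : ℕ → ℕ → ℝ,
    (∀ n, ∀ F : Finset ℕ, n ∉ F → ∑ m ∈ F, a n m ≤ (k + 1) * ε) →
    ∃ φ : ℕ → ℕ, φ.Injective ∧
      ∀ n, ∀ F : Finset ℕ, n ∉ F → ∑ m ∈ F, a (φ n) (φ m) ≤ ε := by
  induction k with
  | zero => exact fun a ha => ⟨id, fun _ _ h => h, by simpa using ha⟩
  | succ k ih =>
    intro a ha
    by_cases h : ∃ i, ∀ n, ∀ F : Finset ℕ, n ∉ F →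
        ∑ m ∈ F, a (Nat.pair i n) (Nat.pair i m) ≤ ε
    · obtain ⟨i, hi⟩ := h
      exact ⟨Nat.pair i, fun m n h => (Nat.pair_eq_pair.1 h).2, hi⟩
    push Not at h
    choose p G hpG hG using h
    have hinj : Function.Injective fun i => Nat.pair i (p i) :=
      fun i j h => (Nat.pair_eq_pair.1 h).1
    obtain ⟨φ, hφ, hφ'⟩ := ih (fun i j => a (Nat.pair i (p i)) (Nat.pair j (p j))) fun n F hn => by
      have hdisj : Disjoint (F.image fun i => Nat.pair i (p i)) ((G n).image (Nat.pair n)) := by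
        simp only [Finset.disjoint_left, Finset.mem_image, not_exists, not_and]
        rintro _ ⟨j, hj, rfl⟩ m - hm
        exact hn ((Nat.pair_eq_pair.1 hm).1 ▸ hj)
      have hnot : Nat.pair n (p n) ∉
          (F.image fun i => Nat.pair i (p i)) ∪ ((G n).image (Nat.pair n)) := by
        simp only [Finset.mem_union, Finset.mem_image, Nat.pair_eq_pair, not_or, not_exists,
          not_and]
        exact ⟨fun j hj hjn => absurd (hjn ▸ hj) hn, fun m hm _ hmp => hpG n (hmp ▸ hm)⟩
      have := ha _ _ hnot
      rw [Finset.sum_union hdisj, Finset.sum_image hinj.injOn,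
        Finset.sum_image fun i _ j _ h => (Nat.pair_eq_pair.1 h).2] at this
      push_cast at this
      linarith [hG n]
    exact ⟨fun n => Nat.pair (φ n) (p (φ n)), hinj.comp hφ, hφ'⟩

/-! ### Embedding `c₀` -/

section CZero

variable {𝕜 E : Type*} [RCLike 𝕜] [NormedAddCommGroup E] [NormedSpace 𝕜 E]

theorem norm_sum_smul_le_of_unit_bound {x : ℕ → E} {C : ℝ}
    (hC : ∀ (F : Finset ℕ) (c : ℕ → 𝕜), (∀ n ∈ F, ‖c n‖ ≤ 1) → ‖∑ n ∈ F, c n • x n‖ ≤ C)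
    (F : Finset ℕ) (c : ℕ → 𝕜) {r : ℝ} (hr : 0 < r) (hc : ∀ n ∈ F, ‖c n‖ ≤ r) :
    ‖∑ n ∈ F, c n • x n‖ ≤ C * r := by
  have h := hC F (fun n => (r : 𝕜)⁻¹ * c n) fun n hn => by
    rw [norm_mul, norm_inv, RCLike.norm_ofReal, abs_of_pos hr, inv_mul_le_iff₀ hr, mul_one]
    exact hc n hn
  simp_rw [mul_smul] at h
  rwa [← Finset.smul_sum, norm_smul, norm_inv, RCLike.norm_ofReal, abs_of_pos hr,
    inv_mul_le_iff₀ hr, mul_comm] at h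

/-- A sequence satisfying an upper `c₀`-estimate, together with norm-one functionals that
are large on the diagonal and small in sum off the diagonal, spans a copy of `c₀`. -/
theorem containsCZero_of_almost_biorthogonal [CompleteSpace E] {x : ℕ → E} {C δ : ℝ} (hδ : 0 < δ)
    (hC : ∀ (F : Finset ℕ) (c : ℕ → 𝕜), (∀ n ∈ F, ‖c n‖ ≤ 1) → ‖∑ n ∈ F, c n • x n‖ ≤ C)
    (f : ℕ → StrongDual 𝕜 E) (hf : ∀ n, ‖f n‖ ≤ 1) (hfx : ∀ n, δ ≤ ‖f n (x n)‖)
    (hoff : ∀ n, ∀ F : Finset ℕ, n ∉ F → ∑ m ∈ F, ‖f n (x m)‖ ≤ δ / 2) :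
    ContainsCZero 𝕜 E := by
  have hC0 : 0 ≤ C := by simpa using hC ∅ 0 (by simp)
  have hcoe : ∀ (a : C₀(ℕ, 𝕜)) n, ‖a n‖ ≤ ‖a‖ := fun a n => by
    simpa using! a.toBCF.norm_coe_le_norm n
  have hsum : ∀ a : C₀(ℕ, 𝕜), Summable fun n => a n • x n := fun a => by
    rw [summable_iff_vanishing_norm]
    intro ε hε
    have hr : 0 < ε / (C + 1) := by positivity
    have ht : Filter.Tendsto a Filter.cofinite (𝓝 0) := by
      rw [← Filter.cocompact_eq_cofinite ℕ]
      exact a.zero_at_infty'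
    have hfin := Filter.eventually_cofinite.1 (ht.eventually (Metric.ball_mem_nhds 0 hr))
    refine ⟨hfin.toFinset, fun F hF => ?_⟩
    refine (norm_sum_smul_le_of_unit_bound hC F a hr fun n hn => ?_).trans_lt ?_
    · have := Finset.disjoint_left.1 hF hn
      simp only [Set.Finite.mem_toFinset, Set.mem_ofPred_eq, not_not] at this
      exact (mem_ball_zero_iff.1 this).le
    · rw [← mul_div_assoc, div_lt_iff₀ (by positivity)]
      nlinarith
  let T₀ : C₀(ℕ, 𝕜) →ₗ[𝕜] E :=
    { toFun := fun a => ∑' n, a n • x n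
      map_add' := fun a b => by
        simp only [ZeroAtInftyContinuousMap.add_apply, add_smul]
        exact (hsum a).tsum_add (hsum b)
      map_smul' := fun c a => by
        simp only [ZeroAtInftyContinuousMap.smul_apply, smul_assoc, RingHom.id_apply]
        exact (hsum a).tsum_const_smul c }
  have hT₀ : ∀ a, ‖T₀ a‖ ≤ C * ‖a‖ := fun a => by
    rcases eq_or_ne a 0 with rfl | ha
    · simp
    · exact le_of_tendsto (hsum a).hasSum.norm (Filter.Eventually.of_forall fun F =>
        norm_sum_smul_le_of_unit_bound hC F a (norm_pos_iff.2 ha) fun n _ => hcoe a n)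
  let T : C₀(ℕ, 𝕜) →L[𝕜] E := T₀.mkContinuous C hT₀
  have hlow : ∀ a n, δ * ‖a n‖ - δ / 2 * ‖a‖ ≤ ‖T a‖ := fun a n => by
    refine ge_of_tendsto (hsum a).hasSum.norm ?_
    filter_upwards [Filter.eventually_ge_atTop {n}] with F hF
    have hn : n ∈ F := by simpa using hF
    have h₁ : ‖∑ m ∈ F.erase n, a m * f n (x m)‖ ≤ δ / 2 * ‖a‖ :=
      calc ‖∑ m ∈ F.erase n, a m * f n (x m)‖ ≤ ∑ m ∈ F.erase n, ‖a‖ * ‖f n (x m)‖ :=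
            norm_sum_le_of_le _ fun m _ => by
              rw [norm_mul]
              exact mul_le_mul_of_nonneg_right (hcoe a m) (norm_nonneg _)
        _ ≤ δ / 2 * ‖a‖ := by
            rw [← Finset.mul_sum, mul_comm]
            exact mul_le_mul_of_nonneg_right (hoff n _ (Finset.notMem_erase n F)) (norm_nonneg _)
    have h₂ : f n (∑ m ∈ F, a m • x m) = a n * f n (x n) + ∑ m ∈ F.erase n, a m * f n (x m) := by
      rw [map_sum, Finset.add_sum_erase F (fun m => a m * f n (x m)) hn]
      simp
    have h₃ : ‖f n (∑ m ∈ F, a m • x m)‖ ≤ ‖∑ m ∈ F, a m • x m‖ :=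
      ((f n).le_opNorm _).trans (mul_le_of_le_one_left (norm_nonneg _) (hf n))
    have h₄ : δ * ‖a n‖ ≤ ‖a n * f n (x n)‖ := by
      rw [norm_mul, mul_comm]
      exact mul_le_mul_of_nonneg_left (hfx n) (norm_nonneg _)
    have h₅ := norm_sub_le_norm_add (a n * f n (x n)) (∑ m ∈ F.erase n, a m * f n (x m))
    rw [← h₂] at h₅
    linarith
  have hbound : ∀ a, ‖a‖ ≤ (⟨2 / δ, by positivity⟩ : NNReal) * ‖T a‖ := fun a => by
    have : ‖a‖ ≤ (‖T a‖ + δ / 2 * ‖a‖) / δ := by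
      rw [← ZeroAtInftyContinuousMap.norm_toBCF_eq_norm (f := a)]
      refine (BoundedContinuousFunction.norm_le (by positivity)).2 fun n => ?_
      rw [le_div_iff₀ hδ]
      have := hlow a n
      rw [← ZeroAtInftyContinuousMap.norm_toBCF_eq_norm (f := a)] at this
      change ‖a n‖ * δ ≤ _
      linarith
    rw [le_div_iff₀ hδ] at this
    change ‖a‖ ≤ 2 / δ * ‖T a‖
    rw [div_mul_eq_mul_div, le_div_iff₀ hδ]
    linarith
  have hanti := ContinuousLinearMap.antilipschitz_of_bound T hbound
  exact ⟨_, ⟨T.equivRange hanti.injective (hanti.isClosed_range T.uniformContinuous)⟩⟩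

/-- Bessaga–Pełczyński: a sequence bounded away from zero that satisfies an upper `c₀`-estimate has
a subsequence spanning a copy of `c₀`. Norming functionals of the members give a matrix with
bounded row sums, from which Rosenthal's lemma selects the subsequence. -/
theorem containsCZero_of_norm_sum_le [CompleteSpace E] {x : ℕ → E} {C δ : ℝ} (hδ : 0 < δ)
    (hx : ∀ n, δ ≤ ‖x n‖)
    (hC : ∀ (F : Finset ℕ) (c : ℕ → 𝕜), (∀ n ∈ F, ‖c n‖ ≤ 1) → ‖∑ n ∈ F, c n • x n‖ ≤ C) :
    ContainsCZero 𝕜 E := by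
  choose f hf hfx using fun n => exists_dual_vector 𝕜 (x n) (hδ.trans_le (hx n)).ne'
  have hrow : ∀ n, ∀ F : Finset ℕ, ∑ m ∈ F, ‖f n (x m)‖ ≤ C := fun n F => by
    choose c hc hc' using fun m => RCLike.exists_norm_eq_mul_self (f n (x m))
    have h := (f n).le_opNorm (∑ m ∈ F, c m • x m)
    rw [map_sum, hf, one_mul] at h
    simp only [map_smul, smul_eq_mul, ← hc', ← RCLike.ofReal_sum, RCLike.norm_ofReal] at h
    exact (le_abs_self _).trans (h.trans (hC F c fun m _ => (hc m).le))
  obtain ⟨k, hk⟩ := exists_nat_ge (C / (δ / 2))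
  rw [div_le_iff₀ (by positivity)] at hk
  obtain ⟨φ, hφ, hoff⟩ := exists_injective_offDiagonal_sum_le (δ / 2) k
    (fun n m => ‖f n (x m)‖) fun n F _ => (hrow n F).trans (by linarith)
  refine containsCZero_of_almost_biorthogonal (x := x ∘ φ) (C := C) hδ (fun F c hc => ?_)
    (fun n => f (φ n)) (fun n => (hf _).le) (fun n => ?_) hoff
  · have hinv := Function.leftInverse_invFun hφ
    have := hC (F.image φ) (fun m => c (Function.invFun φ m)) (by simpa [hinv _] using hc)
    rw [Finset.sum_image hφ.injOn] at this
    simpa [hinv _] using this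
  · simpa [hfx] using hx (φ n)

end CZero

/-! ### Peaking sequences -/

section Peak

variable {𝕜 K E : Type*} [RCLike 𝕜] [TopologicalSpace K] [CompactSpace K]
  [NormedAddCommGroup E] [NormedSpace 𝕜 E]

theorem exists_ne_zero_of_isWeakPeakPoint {H : Submodule 𝕜 C(K, E)} {x : K}
    (hx : IsWeakPeakPoint H x) : ∃ e : E, e ≠ 0 := by
  by_contra! hE
  obtain ⟨h, hh, -, ⟨-, hre⟩, -⟩ := hx (1 / 2) (by norm_num) (by norm_num) 0 _ Filter.univ_mem
  have hz : scalarSpace H ≤ ⊥ := by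
    refine Submodule.topologicalClosure_minimal _ (Submodule.span_le.2 ?_)
      isClosed_singleton
    rintro g ⟨φ, u, -, hg⟩
    exact (Submodule.mem_bot 𝕜).2 (ContinuousMap.ext fun y => by simp [hg, hE (u y)])
  rw [(Submodule.mem_bot 𝕜).1 (hz hh)] at hre
  norm_num at hre

variable [T2Space K]

/-- If the Choquet boundary is infinite and consists of weak peak points, then `H` contains a
sequence bounded away from zero with an upper `c₀`-estimate: functions `hₙ ⊗ e`, where `hₙ` peaks in
the `n`-th of a sequence of disjoint relatively open subsets of the Choquet boundary and is at most
`2⁻⁽ⁿ⁺¹⁾` on the rest of the boundary. -/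
theorem exists_seq_norm_sum_le_of_infinite {H : Submodule 𝕜 C(K, E)}
    (hpeak : ∀ x ∈ choquetBoundary H, IsWeakPeakPoint H x) (hinf : (choquetBoundary H).Infinite) :
    ∃ (u : ℕ → H) (δ C : ℝ), 0 < δ ∧ (∀ n, δ ≤ ‖u n‖) ∧
      ∀ (F : Finset ℕ) (c : ℕ → 𝕜), (∀ n ∈ F, ‖c n‖ ≤ 1) → ‖∑ n ∈ F, c n • u n‖ ≤ C := by
  obtain ⟨x₀, hx₀⟩ := hinf.nonempty
  obtain ⟨e, he⟩ := exists_ne_zero_of_isWeakPeakPoint (hpeak x₀ hx₀)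
  have : Infinite (choquetBoundary H) := hinf.to_subtype
  obtain ⟨W, hWinf, hWo, hWd⟩ := exists_seq_infinite_isOpen_pairwise_disjoint (choquetBoundary H)
  choose U hUo hUW using fun n => isOpen_induced_iff.1 (hWo n)
  choose x hx using fun n => (hWinf n).nonempty
  have hxU : ∀ n, (x n : K) ∈ U n := fun n => by
    have := hx n
    rwa [← hUW n] at this
  have hpos : ∀ n : ℕ, (0 : ℝ) < (1 / 2) ^ (n + 1) := fun n => by positivity
  have hle : ∀ n : ℕ, ((1 : ℝ) / 2) ^ (n + 1) ≤ 1 / 2 := fun n => by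
    rw [pow_succ]
    exact mul_le_of_le_one_left (by norm_num) (pow_le_one₀ (by norm_num) (by norm_num))
  choose h _ hnorm hre hsmall hmem using fun n => hpeak (x n) (x n).2 ((1 / 2) ^ (n + 1)) (hpos n)
    ((hle n).trans_lt (by norm_num)) e (U n) ((hUo n).mem_nhds (hxU n))
  have he0 : 0 < ‖e‖ := norm_pos_iff.2 he
  refine ⟨fun n => ⟨tensor (h n) e, hmem n⟩, ‖e‖ / 2, 2 * ‖e‖, by positivity, fun n => ?_, ?_⟩
  · have h₁ : 1 / 2 ≤ ‖h n (x n)‖ :=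
      (RCLike.re_le_norm _).trans' (by linarith [(hre n).2, hle n])
    calc ‖e‖ / 2 ≤ ‖h n (x n)‖ * ‖e‖ := by nlinarith
      _ = ‖tensor (h n) e (x n)‖ := (norm_smul _ _).symm
      _ ≤ ‖tensor (h n) e‖ := (tensor (h n) e).norm_coe_le_norm _
  · intro F c hc
    -- A point of the Choquet boundary lies in at most one of the sets `U n`, whose traces `W n` are disjoint.
    have hsum : ∀ y ∈ choquetBoundary H, ∑ n ∈ F, ‖h n y‖ ≤ 2 := fun y hy => by
      have hgeom : ∀ G : Finset ℕ, ∑ n ∈ G, ((1 : ℝ) / 2) ^ (n + 1) ≤ 1 := fun G => by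
        simp_rw [pow_succ, ← Finset.sum_mul]
        have := summable_geometric_two.sum_le_tsum G fun n _ => by positivity
        rw [tsum_geometric_two] at this
        linarith
      by_cases hU : ∃ n ∈ F, y ∈ U n
      · obtain ⟨n, hnF, hyn⟩ := hU
        rw [← Finset.add_sum_erase F _ hnF]
        have h₁ : ‖h n y‖ ≤ 1 := ((h n).norm_coe_le_norm y).trans (hnorm n)
        have h₂ : ∑ m ∈ F.erase n, ‖h m y‖ ≤ ∑ m ∈ F.erase n, ((1 : ℝ) / 2) ^ (m + 1) := by
          refine Finset.sum_le_sum fun m hm => hsmall m y ⟨hy, fun hym => ?_⟩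
          have hd : Disjoint (W m) (W n) := hWd (Finset.ne_of_mem_erase hm)
          rw [← hUW m, ← hUW n] at hd
          exact Set.disjoint_left.1 hd (show (⟨y, hy⟩ : choquetBoundary H) ∈ _ from hym) hyn
        linarith [hgeom (F.erase n)]
      · push Not at hU
        have := Finset.sum_le_sum fun n hn => hsmall n y ⟨hy, hU n hn⟩
        linarith [hgeom F]
    set v : H := ∑ n ∈ F, c n • (⟨tensor (h n) e, hmem n⟩ : H) with hv
    rcases eq_or_ne (v : C(K, E)) 0 with h0 | h0
    · rw [Submodule.coe_norm, h0, norm_zero]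
      positivity
    obtain ⟨y, hy, hyn⟩ := exists_mem_choquetBoundary_norm_eq H v.2 h0
    have hval : (v : C(K, E)) y = ∑ n ∈ F, c n • h n y • e := by
      simp [hv, tensor]
    rw [Submodule.coe_norm, ← hyn, hval]
    calc ‖∑ n ∈ F, c n • h n y • e‖ ≤ ∑ n ∈ F, ‖h n y‖ * ‖e‖ :=
          norm_sum_le_of_le _ fun n hn => by
            rw [norm_smul, norm_smul]
            exact mul_le_of_le_one_left (by positivity) (hc n hn)
      _ ≤ 2 * ‖e‖ := by
          rw [← Finset.sum_mul]
          exact mul_le_mul_of_nonneg_right (hsum y hy) (norm_nonneg e)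

/-- If `H` contains a sequence bounded away from zero with an upper `c₀`-estimate and its Choquet
boundary is finite, then `E` contains `c₀`: the members of the sequence attain their norms on the
Choquet boundary, infinitely many of them at the same point, and evaluation there transports them
to `E`. -/
theorem containsCZero_of_finite_choquetBoundary [CompleteSpace E] {H : Submodule 𝕜 C(K, E)}
    (hfin : (choquetBoundary H).Finite) {u : ℕ → H} {δ C : ℝ} (hδ : 0 < δ)
    (hu : ∀ n, δ ≤ ‖u n‖)
    (hC : ∀ (F : Finset ℕ) (c : ℕ → 𝕜), (∀ n ∈ F, ‖c n‖ ≤ 1) → ‖∑ n ∈ F, c n • u n‖ ≤ C) :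
    ContainsCZero 𝕜 E := by
  have hne : ∀ n, (u n : C(K, E)) ≠ 0 := fun n h => by
    have := hδ.trans_le (hu n)
    rw [Submodule.coe_norm, h, norm_zero] at this
    exact this.false
  choose x hx hxn using fun n => exists_mem_choquetBoundary_norm_eq H (u n).2 (hne n)
  have : Finite (choquetBoundary H) := hfin
  obtain ⟨p, hp⟩ := Finite.exists_infinite_fiber fun n => (⟨x n, hx n⟩ : choquetBoundary H)
  let ψ := Set.Infinite.natEmbedding _ (Set.infinite_coe_iff.1 hp)
  have hψ : ∀ n, x (ψ n) = p := fun n => congrArg Subtype.val (ψ n).2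
  refine containsCZero_of_norm_sum_le (𝕜 := 𝕜) (x := fun n => (u (ψ n) : C(K, E)) p) (C := C) hδ
    (fun n => ?_) fun F c hc => ?_
  · rw [← hψ n, hxn]
    exact hu _
  · have hinj : Function.Injective fun n => (ψ n : ℕ) := Subtype.val_injective.comp ψ.injective
    have hinv := Function.leftInverse_invFun hinj
    have := hC (F.image fun n => (ψ n : ℕ))
      (fun m => c (Function.invFun (fun n => (ψ n : ℕ)) m))
      (by simpa [hinv _] using hc)
    rw [Finset.sum_image hinj.injOn] at this
    simp only [hinv _] at this
    refine le_trans ?_ this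
    rw [Submodule.coe_norm]
    refine le_trans (le_of_eq ?_) (ContinuousMap.norm_coe_le_norm _ (p : K))
    simp

end Peak

end VectorFunctionSpace

theorem proposition4p3 {𝕜 : Type*} [RCLike 𝕜]
    {K₁ K₂ : Type*} [TopologicalSpace K₁] [CompactSpace K₁] [T2Space K₁]
    [TopologicalSpace K₂] [CompactSpace K₂] [T2Space K₂]
    {E₁ E₂ : Type*} [NormedAddCommGroup E₁] [NormedSpace 𝕜 E₁] [CompleteSpace E₁]
    [NormedAddCommGroup E₂] [NormedSpace 𝕜 E₂] [CompleteSpace E₂]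
    (H₁ : Submodule 𝕜 C(K₁, E₁)) (H₂ : Submodule 𝕜 C(K₂, E₂))
    (hH₁ : IsClosed (H₁ : Set C(K₁, E₁))) (hH₂ : IsClosed (H₂ : Set C(K₂, E₂)))
    (hpeak₁ : ∀ x ∈ VectorFunctionSpace.choquetBoundary H₁,
      VectorFunctionSpace.IsWeakPeakPoint H₁ x)
    (hpeak₂ : ∀ x ∈ VectorFunctionSpace.choquetBoundary H₂,
      VectorFunctionSpace.IsWeakPeakPoint H₂ x)
    (hE₁ : ¬ VectorFunctionSpace.ContainsCZero 𝕜 E₁)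
    (hfin : (VectorFunctionSpace.choquetBoundary H₁).Finite)
    (hiso : Nonempty (H₁ ≃L[𝕜] H₂)) :
    (VectorFunctionSpace.choquetBoundary H₂).Finite := by
  by_contra hinf
  obtain ⟨T⟩ := hiso
  obtain ⟨u, δ, C, hδ, hu, hC⟩ :=
    VectorFunctionSpace.exists_seq_norm_sum_le_of_infinite hpeak₂ hinf
  have hle : ∀ v, ‖v‖ ≤ (‖(T : H₁ →L[𝕜] H₂)‖ + 1) * ‖T.symm v‖ := fun v => by
    have := (T : H₁ →L[𝕜] H₂).le_opNorm (T.symm v)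
    simp only [ContinuousLinearEquiv.coe_coe, ContinuousLinearEquiv.apply_symm_apply] at this
    linarith [norm_nonneg (T.symm v)]
  refine hE₁ (VectorFunctionSpace.containsCZero_of_finite_choquetBoundary hfin
    (u := fun n => T.symm (u n)) (δ := δ / (‖(T : H₁ →L[𝕜] H₂)‖ + 1))
    (C := ‖(T.symm : H₂ →L[𝕜] H₁)‖ * C) (by positivity) (fun n => ?_) fun F c hc => ?_)
  · rw [div_le_iff₀' (by positivity)]
    exact (hu n).trans (hle _)
  · have := (T.symm : H₂ →L[𝕜] H₁).le_opNorm_of_le (hC F c hc)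
    simpa using this
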